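/- Let $n\ge 2$, $\Omega>0$, and $I(n,\Omega)=\big[-\tfrac{(n-1)\pi}{2\Omega},\tfrac{(n-1)\pi}{2\Omega}\big]$. For a finite measure $\rho$ on $\mathbb R$ write $\mathcal F\rho(\omega)=\int e^{it\omega}\,d\rho(t)$; a positive discrete measure is a finite sum $\rho=\sum_{j=1}^k b_j\delta_{x_j}$ with $b_j>0$ and distinct $x_j$, and $\|\rho\|_0=k$ is its number of Dirac masses. Let $\mu=\sum_{j=1}^n a_j\delta_{y_j}$ with $a_j>0$ and $y_j\in I(n,\Omega)$, let $m_{\min}=\min_j a_j$ and $d_{\min}=\min_{p\ne j}|y_p-y_j|$, and let $$\mathbf Y(\omega)=\mathcal F\mu(\omega)+\mathbf W(\omega),\qquad |\mathbf W(\omega)|<\sigma,\qquad \omega\in[-\Omega,\Omega].$$ Assume that $\sigma\le m_{\min}$ and $$d_{\min}\ \ge\ \frac{5.88\,\pi e}{\Omega}\Big(\frac{\sigma}{m_{\min}}\Big)^{\frac1{2n-1}}.$$ Let $\mathcal O\subseteq I(n,\Omega)$ and consider the minimization problem $$\min \|\rho\|_0\quad\text{over positive discrete measures }\rho\text{ supported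 on }\mathcal O\text{ with } |\mathcal F\rho(\omega)-\mathbf Y(\omega)|<\sigma\text{ for all }\omega\in[-\Omega,\Omega].\tag{P}$$ 1. If $y_1,\dots,y_n\in\mathcal O$ (in particular if $\mathcal O=I(n,\Omega)$), then (P) has a solution, and every solution of (P) consists of exactly $n$ point sources. 2. Every solution $\hat\mu=\sum_{j=1}^n\hat a_j\delta_{\hat y_j}$, $\hat a_j>0$, of (P) is within the $\frac{d_{\min}}2$-neighborhood of $\mu$: the intervals $(y_k-\frac{d_{\min}}2,y_k+\frac{d_{\min}}2)$, $1\le k\le n$, are pairwise disjoint, each $\hat y_j$ lies in exactly one of them, and each of them contains exactly one $\hat y_j$. Moreover, after reordering the $\hat y_j$, $$|\hat y_j-y_j|\le\frac{C(n)}{\Omega}\,\mathrm{SRF}^{2n-2}\,\frac{\sigma}{m_{\min}},\qquad 1\le j\le n,$$ where $\mathrm{SRF}=\frac{\pi}{\Omega d_{\min}}$ and $C(n)=n\,2^{4n-2}e^{2n}\pi^{-1/2}$. -/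

import Mathlib

noncomputable section

namespace PositiveSuperresolution

open MeasureTheory

/-- The measure `∑ j, a j • δ_{y j}` on the line (amplitudes `a j`, locations `y j`). -/
def discreteMeasure {k : ℕ} (a y : Fin k → ℝ) : Measure ℝ :=
  ∑ j, ENNReal.ofReal (a j) • Measure.dirac (y j)

/-- A positive discrete measure: a finite sum of Dirac masses at distinct points, with positive
amplitudes (the empty sum, i.e. the zero measure, is allowed). -/
def IsPositiveDiscrete (ρ : Measure ℝ) : Prop :=
  ∃ (k : ℕ) (a y : Fin k → ℝ), (∀ j, 0 < a j) ∧ Function.Injective y ∧ ρ = discreteMeasure a y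

/-- The Fourier transform `ℱ ρ (ω) = ∫ exp (i t ω) dρ(t)`. -/
def fourierData (ρ : Measure ℝ) (ω : ℝ) : ℂ :=
  ∫ t, Complex.exp (Complex.I * t * ω) ∂ρ

/-- The locations of the Dirac masses (atoms) of a measure. -/
def sources (ρ : Measure ℝ) : Set ℝ := {x | ρ {x} ≠ 0}

/-- `‖ρ‖₀`: the number of Dirac masses of a discrete measure. -/
def l0norm (ρ : Measure ℝ) : ℕ := (sources ρ).ncard

/-- `I(n, Ω) = [-(n-1)π/(2Ω), (n-1)π/(2Ω)]`. -/
def sourceInterval (n : ℕ) (Ω : ℝ) : Set ℝ :=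
  Set.Icc (-(((n : ℝ) - 1) * Real.pi / (2 * Ω))) (((n : ℝ) - 1) * Real.pi / (2 * Ω))

/-- The smallest amplitude (used for `n ≥ 1`, where the infimum is a minimum). -/
def mMin {n : ℕ} (a : Fin n → ℝ) : ℝ := ⨅ j, a j

/-- The minimal separation `min_{p ≠ j} |y_p - y_j|` (used for `n ≥ 2`, where the infimum is a
minimum over a finite nonempty set of pairs). -/
def dMin {n : ℕ} (y : Fin n → ℝ) : ℝ :=
  ⨅ p : {p : Fin n × Fin n // p.1 ≠ p.2}, |y p.1.1 - y p.1.2|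

/-- The super-resolution factor `π / (Ω d_min)`. -/
def superResolutionFactor (Ω d : ℝ) : ℝ := Real.pi / (Ω * d)

/-- `C(n) = n 2^(4n-2) e^(2n) π^(-1/2)` (used for `n ≥ 2`). -/
def locationConstant (n : ℕ) : ℝ :=
  n * 2 ^ (4 * n - 2) * Real.exp 1 ^ (2 * n) * Real.pi ^ (-(1 / 2) : ℝ)

/-- The constraints of the `ℓ⁰`-minimization problem: `ρ` is a positive discrete measure supported
on `O` whose Fourier data are within `σ` of `Y` at every frequency of `[-Ω, Ω]`. -/
structure IsFeasible (O : Set ℝ) (Ω σ : ℝ) (Y : ℝ → ℂ) (ρ : Measure ℝ) : Prop where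
  discrete : IsPositiveDiscrete ρ
  supported : sources ρ ⊆ O
  close : ∀ ω ∈ Set.Icc (-Ω) Ω, ‖fourierData ρ ω - Y ω‖ < σ

/-- `ρ` is a solution of the `ℓ⁰`-minimization problem: feasible, with the least number of Dirac
masses among all feasible measures. -/
structure IsL0Solution (O : Set ℝ) (Ω σ : ℝ) (Y : ℝ → ℂ) (ρ : Measure ℝ) : Prop where
  feasible : IsFeasible O Ω σ Y ρ
  minimal : ∀ ρ' : Measure ℝ, IsFeasible O Ω σ Y ρ' → l0norm ρ ≤ l0norm ρ'

/-- A measure with locations `y'` is within the `δ`-neighborhood of a measure with locations `y`: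
the intervals `(y_k - δ, y_k + δ)` are pairwise disjoint, every `y'_j` is in exactly one of them,
and each of them contains exactly one `y'_j`. -/
structure IsWithinNeighborhood {n : ℕ} (δ : ℝ) (y y' : Fin n → ℝ) : Prop where
  pos : 0 < δ
  disjoint : Pairwise fun k l =>
    Disjoint (Set.Ioo (y k - δ) (y k + δ)) (Set.Ioo (y l - δ) (y l + δ))
  mem_unique : ∀ j, ∃! k, y' j ∈ Set.Ioo (y k - δ) (y k + δ)
  unique_mem : ∀ k, ∃! j, y' j ∈ Set.Ioo (y k - δ) (y k + δ)

end PositiveSuperresolution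

end

namespace PositiveSuperresolution

open MeasureTheory Finset

/-! ### Numerical estimates -/

/-! The Fourier data of `μ` and of any feasible `ρ` differ by at most `2σ` on the band. Let `z` list
`n` points of the interval containing every atom of `ρ`. Test `μ - ρ` against `exp(-iΩt) ∏ (exp(iht)
- exp(ihv))`, with `v` running over all `z l` and all `y p`, `p ≠ j`. For `h = 2Ω/(2n-1)` the
frequencies stay in the band, and only the atom at `y j` can survive. Comparing chords with arcs
gives `∏ |y j - z l| * ∏ |y j - y p| ≤ ε` with `ε` proportional to `σ / m_min`
(`prod_dist_mul_prod_dist_le`).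

Separation bounds the second product below (`factorial_mul_pow_le_prod`). Lagrange's formula for the
leading coefficient of a monic polynomial with roots among the `z l` would then give a value below
1, unless every `z l` is near some `y j` and no two are near the same one (`exists_dist_lt_half`,
`eq_of_dist_lt_half`). The resulting matching, put back into the product inequality, bounds each
displacement (`dist_le_of_matching`). A feasible measure with fewer than `n` atoms could be padded
to a list with a repetition, which the matching excludes; so the minimum is `n`. -/

theorem pow_self_le_factorial_sq (m : ℕ) (hm : 1 ≤ m) :
    (2 * (m : ℝ) + 1) ^ (2 * m + 1) ≤
      (2 * m + 1) * 4 ^ m * Real.exp 1 ^ (2 * m + 1) * (m.factorial : ℝ) ^ 2 := by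
  have hm0 : (0 : ℝ) < m := by exact_mod_cast hm
  have hf : (0 : ℝ) < m.factorial := by exact_mod_cast m.factorial_pos
  have h1 : (m : ℝ) ^ m ≤ Real.exp 1 ^ m * m.factorial := by
    have h := Real.pow_div_factorial_le_exp (m : ℝ) hm0.le m
    rw [div_le_iff₀ hf] at h
    rwa [← Real.exp_nat_mul, mul_one]
  have h2 : (1 + 1 / (2 * (m : ℝ))) ^ (2 * m) ≤ Real.exp 1 := by
    have h := Real.add_one_le_exp (1 / (2 * (m : ℝ)))
    calc (1 + 1 / (2 * (m : ℝ))) ^ (2 * m) ≤ Real.exp (1 / (2 * (m : ℝ))) ^ (2 * m) := by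
          gcongr; linarith
      _ = Real.exp 1 := by
          rw [← Real.exp_nat_mul]; congr 1; push_cast; field_simp
  -- Passing from `2m` to `2m+1` in the base costs only one factor `e`, by `h2`.
  have h3 : (2 * (m : ℝ) + 1) ^ (2 * m) =
      4 ^ m * ((m : ℝ) ^ m) ^ 2 * (1 + 1 / (2 * (m : ℝ))) ^ (2 * m) := by
    have : (2 * (m : ℝ) + 1) = 2 * m * (1 + 1 / (2 * (m : ℝ))) := by field_simp
    rw [this, mul_pow, mul_pow, pow_mul 2 2 m, ← pow_mul (m : ℝ) m 2, mul_comm m 2]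
    norm_num
  have h4 : (2 * (m : ℝ) + 1) ^ (2 * m) ≤
      4 ^ m * (Real.exp 1 ^ m * m.factorial) ^ 2 * Real.exp 1 := by
    rw [h3]; gcongr
  calc (2 * (m : ℝ) + 1) ^ (2 * m + 1) = (2 * m + 1) * (2 * (m : ℝ) + 1) ^ (2 * m) := by ring
    _ ≤ (2 * m + 1) * (4 ^ m * (Real.exp 1 ^ m * m.factorial) ^ 2 * Real.exp 1) := by gcongr
    _ = _ := by ring

/-- This is where the constant 5.88 = 11.76/2 enters: it is what remains of the smallness condition
`4nε < dB²` after cancellation. -/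
theorem separation_constant_bound (m : ℕ) (hm : 1 ≤ m) :
    8 * ((m : ℝ) + 1) * (2 * m + 1) * 16 ^ m < 11.76 ^ (2 * m + 1) := by
  -- `138 < 11.76²`, so an induction with ratio 138 suffices.
  have key : 8 * ((m : ℝ) + 1) * (2 * m + 1) * 16 ^ m < 11.76 * 138 ^ m := by
    induction m, hm using Nat.le_induction with
    | base => norm_num
    | succ k hk ih =>
      have hk' : (1 : ℝ) ≤ k := by exact_mod_cast hk
      have h16 : (0 : ℝ) < 16 ^ k := by positivity
      push_cast
      rw [pow_succ, pow_succ]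
      have : 8 * ((k : ℝ) + 1 + 1) * (2 * (k + 1) + 1) * 16 ≤
          138 * (8 * ((k : ℝ) + 1) * (2 * k + 1)) := by nlinarith
      nlinarith [mul_le_mul_of_nonneg_right this h16.le]
  refine key.trans_le ?_
  rw [pow_succ, pow_mul, mul_comm]
  gcongr
  norm_num

theorem location_constant_bound (m : ℕ) (hm : 1 ≤ m) :
    8 ^ m * Real.pi * (2 * (m : ℝ) + 1) * Real.exp 1 ^ (2 * m + 1) ≤ locationConstant (m + 1) := by
  have hpi : (1 : ℝ) / 2 ≤ Real.pi ^ (-(1 / 2) : ℝ) := by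
    rw [Real.rpow_neg Real.pi_pos.le, ← Real.sqrt_eq_rpow, one_div]
    apply inv_anti₀ (Real.sqrt_pos.2 Real.pi_pos)
    rw [Real.sqrt_le_left (by norm_num)]
    linarith [Real.pi_le_four]
  have he : Real.pi ≤ 2 * Real.exp 1 := by linarith [Real.pi_le_four, Real.exp_one_gt_d9]
  have h2 : (2 : ℝ) ≤ 2 ^ m := by
    calc (2 : ℝ) = 2 ^ 1 := by norm_num
      _ ≤ 2 ^ m := pow_le_pow_right₀ (by norm_num) hm
  have h16 : (2 : ℝ) ^ (4 * (m + 1) - 2) = 4 * (2 ^ m * 8 ^ m) := by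
    rw [show 4 * (m + 1) - 2 = 4 * m + 2 by omega, pow_add, pow_mul, ← mul_pow]
    norm_num
    ring
  have hm0 : (0 : ℝ) ≤ m := m.cast_nonneg
  unfold locationConstant
  rw [h16]
  push_cast
  calc 8 ^ m * Real.pi * (2 * (m : ℝ) + 1) * Real.exp 1 ^ (2 * m + 1)
      ≤ 8 ^ m * (2 * Real.exp 1) * (2 * ((m : ℝ) + 1)) * Real.exp 1 ^ (2 * m + 1) := by
        gcongr; linarith
    _ = ((m : ℝ) + 1) * (4 * (2 * 8 ^ m)) * Real.exp 1 ^ (2 * (m + 1)) * (1 / 2) := by ring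
    _ ≤ _ := by gcongr

/-! ### Separated points on the line -/

theorem card_mul_le_of_separated {ι : Type*} [DecidableEq ι] (y : ι → ℝ) (d : ℝ)
    (T : Finset ι) (a b : ℝ) (hT : T.Nonempty)
    (hsep : ∀ i ∈ T, ∀ j ∈ T, i ≠ j → d ≤ |y i - y j|)
    (hab : ∀ i ∈ T, y i ∈ Set.Icc a b) : ((#T : ℝ) - 1) * d ≤ b - a := by
  induction hn : #T generalizing T b with
  | zero => exact absurd (Finset.card_eq_zero.1 hn) hT.ne_empty
  | succ k ih =>
    obtain ⟨x, hx, hmax⟩ := T.exists_max_image y hT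
    have hcard : #(T.erase x) = k := by rw [card_erase_of_mem hx, hn]; rfl
    rcases (T.erase x).eq_empty_or_nonempty with h0 | h0
    · rw [h0, card_empty] at hcard
      subst hcard
      have := hab x hx
      simp only [Set.mem_Icc] at this
      simp; linarith
    · have h := ih (T.erase x) (y x - d) h0
        (fun i hi j hj => hsep i (mem_of_mem_erase hi) j (mem_of_mem_erase hj))
        (fun i hi => by
          have h1 := hsep x hx i (mem_of_mem_erase hi) (ne_of_mem_erase hi).symm
          have h2 := hmax i (mem_of_mem_erase hi)
          rw [abs_of_nonneg (by linarith)] at h1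
          exact ⟨(hab i (mem_of_mem_erase hi)).1, by linarith⟩) hcard
      have := (hab x hx).2
      push_cast
      linarith

/-- Remove the point farthest from `y x`, at distance `r`: all `k + 2` points lie in an interval of
length `2r`, so `(k + 1) d ≤ 2r`. -/
theorem factorial_mul_pow_le_prod {ι : Type*} [DecidableEq ι] (y : ι → ℝ) (d : ℝ) (hd : 0 ≤ d)
    (x : ι) (S : Finset ι) (hx : x ∉ S)
    (hsep : ∀ i ∈ insert x S, ∀ j ∈ insert x S, i ≠ j → d ≤ |y i - y j|) :
    ((#S).factorial : ℝ) * (d / 2) ^ #S ≤ ∏ p ∈ S, |y x - y p| := by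
  induction hn : #S generalizing S with
  | zero => rw [Finset.card_eq_zero.1 hn]; simp
  | succ k ih =>
    have hne : S.Nonempty := card_pos.1 (by omega)
    obtain ⟨s, hs, hmax⟩ := S.exists_max_image (fun p => |y x - y p|) hne
    have hcard : #(S.erase s) = k := by rw [card_erase_of_mem hs, hn]; rfl
    have hsub : insert x (S.erase s) ⊆ insert x S := insert_subset_insert _ (erase_subset _ _)
    have h := ih (S.erase s) (fun hx' => hx (mem_of_mem_erase hx'))
      (fun i hi j hj => hsep i (hsub hi) j (hsub hj)) hcard
    have hr := card_mul_le_of_separated y d (insert x S) (y x - |y x - y s|) (y x + |y x - y s|)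
      (insert_nonempty _ _) hsep (fun i hi => by
        have : |y x - y i| ≤ |y x - y s| := by
          rcases mem_insert.1 hi with rfl | hi
          · simp
          · exact hmax i hi
        rw [abs_le] at this
        exact ⟨by linarith, by linarith⟩)
    rw [card_insert_of_notMem hx, hn] at hr
    push_cast at hr
    rw [← mul_prod_erase S _ hs, Nat.factorial_succ]
    push_cast
    calc ((k : ℝ) + 1) * k.factorial * (d / 2) ^ (k + 1)
        = (((k : ℝ) + 1) * (d / 2)) * (k.factorial * (d / 2) ^ k) := by ring
      _ ≤ |y x - y s| * ∏ p ∈ S.erase s, |y x - y p| := by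
          gcongr
          linarith

/-! ### Divided differences and localization of the roots -/

/-- The sum is the divided difference of a monic polynomial of degree `#s - 1`, that is, its leading
coefficient. -/
theorem sum_prod_sub_div_eq_one {ι κ : Type*} [DecidableEq ι] (s : Finset ι) (v : ι → ℝ)
    (hv : Set.InjOn v s) (t : Finset κ) (z : κ → ℝ) (h : #s = #t + 1) :
    ∑ i ∈ s, (∏ l ∈ t, (v i - z l)) / ∏ j ∈ s.erase i, (v i - v j) = 1 := by
  have hmon : (∏ l ∈ t, (Polynomial.X - Polynomial.C (z l))).Monic :=
    Polynomial.monic_prod_of_monic _ _ fun l _ => Polynomial.monic_X_sub_C (z l)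
  have hdeg : (∏ l ∈ t, (Polynomial.X - Polynomial.C (z l))).degree = ((#t : ℕ) : WithBot ℕ) := by
    rw [Polynomial.degree_eq_natDegree hmon.ne_zero,
      Polynomial.natDegree_prod_of_monic _ _ fun l _ => Polynomial.monic_X_sub_C (z l)]
    simp
  have := Lagrange.leadingCoeff_eq_sum hv
    (P := ∏ l ∈ t, (Polynomial.X - Polynomial.C (z l))) (by rw [hdeg, h]; rfl)
  rw [hmon.leadingCoeff] at this
  simpa [Polynomial.eval_prod] using this.symm

section Localization

variable {ι : Type*} [Fintype ι] [DecidableEq ι] {y z : ι → ℝ} {d ε B : ℝ}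

theorem exists_dist_lt_half (hd : 0 < d) (hB : 0 < B) (hne : Nonempty ι)
    (hsep : ∀ i j, i ≠ j → d ≤ |y i - y j|)
    (hBP : ∀ j, B ≤ ∏ p ∈ univ.erase j, |y j - y p|)
    (hprod : ∀ j, (∏ l, |y j - z l|) * ∏ p ∈ univ.erase j, |y j - y p| ≤ ε)
    (hε : 4 * (Fintype.card ι : ℝ) * ε < d * B ^ 2) (l : ι) : ∃ j, |y j - z l| < d / 2 := by
  by_contra! hcon
  have hinj : Set.InjOn y (univ : Finset ι) := fun i _ j _ hij => by
    by_contra hne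
    have := hsep i j hne
    rw [hij, sub_self, abs_zero] at this
    linarith
  -- Dropping the root `z l`, which is at least `d/2` from every node, makes each term at most
  -- `2ε/(dB²)`.
  have hid := sum_prod_sub_div_eq_one univ y hinj (univ.erase l) z (by
    rw [card_erase_of_mem (mem_univ l), card_univ]
    have := Fintype.card_pos (α := ι)
    omega)
  have hterm : ∀ j ∈ (univ : Finset ι), (∏ l' ∈ univ.erase l, (y j - z l')) /
      ∏ p ∈ univ.erase j, (y j - y p) ≤ 2 * ε / (d * B ^ 2) := by
    intro j _
    refine (le_abs_self _).trans ?_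
    rw [abs_div, abs_prod, abs_prod]
    have hP := hBP j
    have h := hprod j
    rw [← mul_prod_erase univ _ (mem_univ l)] at h
    set P := ∏ p ∈ univ.erase j, |y j - y p|
    set Q := ∏ l' ∈ univ.erase l, |y j - z l'| with hQ
    have hQ0 : 0 ≤ Q := prod_nonneg fun _ _ => abs_nonneg _
    have hP0 : 0 < P := hB.trans_le hP
    have h1 : d / 2 * Q * P ≤ ε := le_trans (by gcongr; exact hcon j) h
    rw [div_le_div_iff₀ hP0 (by positivity)]
    calc Q * (d * B ^ 2) ≤ Q * (d * P ^ 2) := by gcongr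
      _ = 2 * (d / 2 * Q * P) * P := by ring
      _ ≤ 2 * ε * P := by gcongr
  have hsum := sum_le_card_nsmul _ _ _ hterm
  rw [hid, nsmul_eq_mul, card_univ, ← mul_div_assoc, le_div_iff₀ (by positivity)] at hsum
  have : 0 ≤ (Fintype.card ι : ℝ) * ε := by nlinarith [show 0 < d * B ^ 2 by positivity]
  linarith

theorem eq_of_dist_lt_half (hd : 0 < d) (hB : 0 < B)
    (hsep : ∀ i j, i ≠ j → d ≤ |y i - y j|)
    (hBP : ∀ j, B ≤ ∏ p ∈ univ.erase j, |y j - y p|)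
    (hprod : ∀ j, (∏ l, |y j - z l|) * ∏ p ∈ univ.erase j, |y j - y p| ≤ ε)
    (hε : 4 * (Fintype.card ι : ℝ) * ε < d * B ^ 2) {l₁ l₂ j₀ : ι}
    (h₁ : |y j₀ - z l₁| < d / 2) (h₂ : |y j₀ - z l₂| < d / 2) : l₁ = l₂ := by
  by_contra hl
  have hinj : Set.InjOn y (univ.erase j₀ : Finset ι) := fun i _ j _ hij => by
    by_contra hne
    have := hsep i j hne
    rw [hij, sub_self, abs_zero] at this
    linarith
  have hmem : l₂ ∈ univ.erase l₁ := mem_erase.2 ⟨Ne.symm hl, mem_univ _⟩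
  have hcard : 2 ≤ Fintype.card ι := by
    have := Fintype.one_lt_card_iff.2 ⟨l₁, l₂, hl⟩
    omega
  -- Dropping both clustered roots and the node `y j₀` keeps the degree one below the number of
  -- nodes.
  have hid := sum_prod_sub_div_eq_one (univ.erase j₀) y hinj ((univ.erase l₁).erase l₂) z (by
    rw [card_erase_of_mem hmem, card_erase_of_mem (mem_univ l₁),
      card_erase_of_mem (mem_univ j₀), card_univ]
    omega)
  have hε0 : 0 ≤ ε := le_trans (mul_nonneg (prod_nonneg fun _ _ => abs_nonneg _)
    (prod_nonneg fun _ _ => abs_nonneg _)) (hprod j₀)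
  have hterm : ∀ j ∈ univ.erase j₀, (∏ l' ∈ (univ.erase l₁).erase l₂, (y j - z l')) /
      ∏ p ∈ (univ.erase j₀).erase j, (y j - y p) ≤ 4 * ε / (d * B ^ 2) := by
    intro j hj
    have hjne : j ≠ j₀ := ne_of_mem_erase hj
    refine (le_abs_self _).trans ?_
    rw [abs_div, abs_prod, abs_prod]
    have hP := hBP j
    have h := hprod j
    have hPeq : ∏ p ∈ univ.erase j, |y j - y p| =
        |y j - y j₀| * ∏ p ∈ (univ.erase j₀).erase j, |y j - y p| := by
      rw [erase_right_comm, mul_prod_erase _ (fun p => |y j - y p|)]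
      exact mem_erase.2 ⟨hjne.symm, mem_univ _⟩
    rw [← mul_prod_erase univ _ (mem_univ l₁), ← mul_prod_erase _ _ hmem] at h
    set P := ∏ p ∈ univ.erase j, |y j - y p|
    set R := ∏ p ∈ (univ.erase j₀).erase j, |y j - y p|
    set Q := ∏ l' ∈ (univ.erase l₁).erase l₂, |y j - z l'|
    have hQ0 : 0 ≤ Q := prod_nonneg fun _ _ => abs_nonneg _
    have hP0 : 0 < P := hB.trans_le hP
    have hD : d ≤ |y j - y j₀| := hsep j j₀ hjne
    set D := |y j - y j₀|
    have hD0 : 0 < D := hd.trans_le hD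
    have hR0 : 0 < R := by
      rw [hPeq] at hP0
      exact pos_of_mul_pos_right hP0 hD0.le
    -- Each dropped root contributes `D/2`; one of the two factors `D` pays for the node removed
    -- from the denominator, since `P = D * R`.
    have half : ∀ l, |y j₀ - z l| < d / 2 → D / 2 ≤ |y j - z l| := fun l hl => by
      have : D ≤ |y j - z l| + |z l - y j₀| := abs_sub_le _ _ _
      rw [abs_sub_comm (z l)] at this
      linarith
    have h1 : D / 2 * (D / 2 * Q) * P ≤ ε :=
      le_trans (by gcongr; exacts [half l₁ h₁, half l₂ h₂]) h
    rw [div_le_div_iff₀ hR0 (by positivity)]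
    refine le_of_mul_le_mul_left ?_ hD0
    calc D * (Q * (d * B ^ 2)) ≤ D * (Q * (D * P ^ 2)) := by gcongr
      _ = 4 * (D / 2 * (D / 2 * Q) * P) * P := by ring
      _ ≤ 4 * ε * P := by gcongr
      _ = D * (4 * ε * R) := by rw [hPeq]; ring
  have hsum := sum_le_card_nsmul _ _ _ hterm
  rw [hid, nsmul_eq_mul, ← mul_div_assoc, le_div_iff₀ (by positivity)] at hsum
  have hle : (#(univ.erase j₀) : ℝ) ≤ Fintype.card ι := by
    exact_mod_cast (card_erase_le (s := univ) (a := j₀))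
  have : (#(univ.erase j₀) : ℝ) * (4 * ε) ≤ Fintype.card ι * (4 * ε) := by gcongr
  linarith

theorem dist_le_of_matching (hB : 0 < B)
    (hsep : ∀ i j, i ≠ j → d ≤ |y i - y j|)
    (hBP : ∀ j, B ≤ ∏ p ∈ univ.erase j, |y j - y p|)
    (hprod : ∀ j, (∏ l, |y j - z l|) * ∏ p ∈ univ.erase j, |y j - y p| ≤ ε)
    (τ : Equiv.Perm ι) (hτ : ∀ j, |y j - z (τ j)| < d / 2) (j : ι) :
    |y j - z (τ j)| ≤ 2 ^ (Fintype.card ι - 1) * ε / B ^ 2 := by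
  have h := hprod j
  rw [← Equiv.prod_comp τ, ← mul_prod_erase univ _ (mem_univ j)] at h
  have hP := hBP j
  -- Moving `y p` to its match changes its distance to `y j` by less than `d/2`, so at least half of
  -- that distance remains.
  have hQ : (∏ p ∈ univ.erase j, |y j - y p|) / 2 ^ (Fintype.card ι - 1) ≤
      ∏ p ∈ univ.erase j, |y j - z (τ p)| := by
    have hc : #(univ.erase j) = Fintype.card ι - 1 := by
      rw [card_erase_of_mem (mem_univ j), card_univ]
    rw [← hc, ← prod_const, ← prod_div_distrib]
    refine prod_le_prod (fun _ _ => by positivity) fun p hp => ?_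
    have h1 := hsep j p (ne_of_mem_erase hp).symm
    have h2 : |y j - y p| ≤ |y j - z (τ p)| + |z (τ p) - y p| := abs_sub_le _ _ _
    have h3 := hτ p
    rw [abs_sub_comm] at h3
    linarith
  set P := ∏ p ∈ univ.erase j, |y j - y p|
  have hP0 : 0 < P := hB.trans_le hP
  rw [le_div_iff₀ (by positivity)]
  calc |y j - z (τ j)| * B ^ 2 ≤ |y j - z (τ j)| * P ^ 2 := by gcongr
    _ = 2 ^ (Fintype.card ι - 1) *
        (|y j - z (τ j)| * (P / 2 ^ (Fintype.card ι - 1)) * P) := by field_simp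
    _ ≤ 2 ^ (Fintype.card ι - 1) * ε := by
      gcongr
      exact le_trans (by gcongr) h

end Localization

/-! ### Trigonometric test functions -/

theorem two_div_pi_mul_le_norm_exp_sub {a b : ℝ} (h : |a - b| ≤ Real.pi) :
    2 / Real.pi * |a - b| ≤ ‖Complex.exp (Complex.I * a) - Complex.exp (Complex.I * b)‖ := by
  have h1 : Complex.exp (Complex.I * a) - Complex.exp (Complex.I * b) =
      Complex.exp (Complex.I * b) * (Complex.exp (Complex.I * (a - b : ℝ)) - 1) := by
    rw [mul_sub, ← Complex.exp_add]
    push_cast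
    ring_nf
  rw [h1, norm_mul, mul_comm Complex.I (b : ℂ), Complex.norm_exp_ofReal_mul_I, one_mul,
    Complex.norm_exp_I_mul_ofReal_sub_one, norm_mul, Real.norm_eq_abs, Real.norm_eq_abs,
    abs_two]
  have h2 := Real.mul_abs_le_abs_sin (x := (a - b) / 2) (by
    rw [abs_div, abs_two]; linarith)
  rw [abs_div, abs_two] at h2
  linarith

theorem fourierData_discreteMeasure {k : ℕ} (a x : Fin k → ℝ) (ha : ∀ j, 0 < a j) (ω : ℝ) :
    fourierData (discreteMeasure a x) ω =
      ∑ j, (a j : ℂ) * Complex.exp (Complex.I * x j * ω) := by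
  unfold fourierData discreteMeasure
  rw [integral_finsetSum_measure]
  · refine sum_congr rfl fun j _ => ?_
    rw [integral_smul_measure, integral_dirac, ENNReal.toReal_ofReal (ha j).le]
    simp
  · intro j _
    refine Integrable.smul_measure ?_ ENNReal.ofReal_ne_top
    exact integrable_dirac (by simp)

/-- Bounds on the Fourier data of a signed discrete measure propagate to products of differences
of exponentials whose frequencies stay inside the band. -/
theorem norm_pairing_prod_le {ι κ : Type*} [Fintype ι] [DecidableEq κ] (c : ι → ℂ) (x : ι → ℝ)
    (Ω h δ : ℝ) (hh : 0 ≤ h)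
    (hδ : ∀ ω ∈ Set.Icc (-Ω) Ω, ‖∑ i, c i * Complex.exp (Complex.I * x i * ω)‖ ≤ δ)
    (w : κ → ℂ) (hw : ∀ k, ‖w k‖ = 1) (T : Finset κ) (ω₀ : ℝ) (h0 : -Ω ≤ ω₀)
    (h1 : ω₀ + #T * h ≤ Ω) :
    ‖∑ i, c i * (Complex.exp (Complex.I * x i * ω₀) *
      ∏ k ∈ T, (Complex.exp (Complex.I * x i * h) - w k))‖ ≤ 2 ^ #T * δ := by
  induction T using Finset.induction_on generalizing ω₀ with
  | empty => simpa using hδ ω₀ ⟨h0, by simpa using h1⟩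
  | insert k T hk ih =>
    rw [card_insert_of_notMem hk] at h1 ⊢
    push_cast at h1
    have e1 := ih (ω₀ + h) (by linarith) (by linarith)
    have e2 := ih ω₀ h0 (by linarith)
    -- Each new factor gives a pairing shifted by `h` minus a unimodular multiple of the unshifted
    -- one, so the bound doubles.
    have hsplit : ∑ i, c i * (Complex.exp (Complex.I * x i * ω₀) *
          ∏ k ∈ insert k T, (Complex.exp (Complex.I * x i * h) - w k)) =
        ∑ i, c i * (Complex.exp (Complex.I * x i * (ω₀ + h : ℝ)) *
          ∏ k ∈ T, (Complex.exp (Complex.I * x i * h) - w k)) -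
        w k * ∑ i, c i * (Complex.exp (Complex.I * x i * ω₀) *
          ∏ k ∈ T, (Complex.exp (Complex.I * x i * h) - w k)) := by
      rw [mul_sum, ← sum_sub_distrib]
      refine sum_congr rfl fun i _ => ?_
      rw [prod_insert hk]
      push_cast
      rw [mul_add, Complex.exp_add]
      ring
    rw [hsplit]
    calc _ ≤ _ := norm_sub_le _ _
      _ ≤ 2 ^ #T * δ + 1 * (2 ^ #T * δ) := by
        rw [norm_mul, hw k]
        gcongr
      _ = _ := by ring

/-- The main stability inequality: `ρ` is any discrete measure whose atoms are among the `z l`. -/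
theorem prod_dist_mul_prod_dist_le {n k : ℕ} (hn : 1 ≤ n) {Ω σ : ℝ} (hΩ : 0 < Ω)
    (a y : Fin n → ℝ) (ha : ∀ j, 0 < a j) (hy : ∀ j, y j ∈ sourceInterval n Ω)
    (b x : Fin k → ℝ) (hb : ∀ j, 0 < b j) (z : Fin n → ℝ)
    (hz : ∀ l, z l ∈ sourceInterval n Ω) (hxz : ∀ i, ∃ l, z l = x i)
    (hclose : ∀ ω ∈ Set.Icc (-Ω) Ω,
      ‖fourierData (discreteMeasure a y) ω - fourierData (discreteMeasure b x) ω‖ ≤ 2 * σ)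
    (j : Fin n) :
    a j * ((4 * Ω / ((2 * n - 1) * Real.pi)) ^ (2 * n - 1) *
      ((∏ l, |y j - z l|) * ∏ p ∈ univ.erase j, |y j - y p|)) ≤ 2 ^ (2 * n - 1) * (2 * σ) := by
  have hn' : (1 : ℝ) ≤ n := by exact_mod_cast hn
  set N : ℝ := 2 * n - 1 with hN
  have hN1 : 1 ≤ N := by linarith
  -- `N` factors of step `h`, starting at `-Ω`, exactly fill the band; on the source interval phase
  -- differences stay below `π`.
  set h : ℝ := 2 * Ω / N with hh
  have hh0 : 0 < h := by positivity
  let c : Fin n ⊕ Fin k → ℂ := Sum.elim (fun i => (a i : ℂ)) (fun i => -(b i : ℂ))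
  let X : Fin n ⊕ Fin k → ℝ := Sum.elim y x
  let v : Fin n ⊕ Fin n → ℝ := Sum.elim z y
  let T : Finset (Fin n ⊕ Fin n) := univ.disjSum (univ.erase j)
  have hTcard : #T = 2 * n - 1 := by
    rw [card_disjSum, card_erase_of_mem (mem_univ j), card_univ, Fintype.card_fin]
    omega
  have hTN : (#T : ℝ) = N := by
    rw [hTcard, Nat.cast_sub (by omega)]; push_cast; rfl
  have hmain := norm_pairing_prod_le c X Ω h (2 * σ) hh0.le (fun ω hω => by
      have := hclose ω hω
      rw [fourierData_discreteMeasure a y ha, fourierData_discreteMeasure b x hb] at this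
      simpa [c, X, Fintype.sum_sum_type, sub_eq_add_neg] using this)
    (fun q => Complex.exp (Complex.I * v q * h))
    (fun q => by
      rw [show Complex.I * v q * h = ((v q * h : ℝ) : ℂ) * Complex.I by push_cast; ring]
      exact Complex.norm_exp_ofReal_mul_I _)
    T (-Ω) le_rfl (by rw [hTN, hh]; field_simp; linarith)
  have hfac : ∀ i : Fin n ⊕ Fin k, i ≠ Sum.inl j →
      ∏ q ∈ T, (Complex.exp (Complex.I * X i * h) - Complex.exp (Complex.I * v q * h)) = 0 := by
    intro i hi
    have : ∃ q ∈ T, v q = X i := by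
      rcases i with i | i
      · exact ⟨Sum.inr i, by simp [T]; exact fun h => hi (by rw [h]), rfl⟩
      · obtain ⟨l, hl⟩ := hxz i
        exact ⟨Sum.inl l, by simp [T], hl⟩
    obtain ⟨q, hq, hv⟩ := this
    exact prod_eq_zero hq (by rw [hv, sub_self])
  rw [Fintype.sum_eq_single (Sum.inl j) (fun i hi => by rw [hfac i hi, mul_zero, mul_zero]),
    hTcard] at hmain
  refine le_trans ?_ hmain
  rw [norm_mul, norm_mul, norm_prod,
    show Complex.I * X (Sum.inl j) * ((-Ω : ℝ) : ℂ) = ((y j * (-Ω) : ℝ) : ℂ) * Complex.I by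
      simp only [X, Sum.elim_inl]; push_cast; ring,
    Complex.norm_exp_ofReal_mul_I, one_mul]
  have hc : ‖c (Sum.inl j)‖ = a j := by
    simp only [c, Sum.elim_inl, Complex.norm_real, Real.norm_eq_abs, abs_of_pos (ha j)]
  rw [hc]
  gcongr
  · exact (ha j).le
  have hv : ∀ q, v q ∈ sourceInterval n Ω := by
    rintro (q | q)
    exacts [hz q, hy q]
  have hprod : ∏ q ∈ T, (4 * Ω / (N * Real.pi) * |y j - v q|) =
      (4 * Ω / (N * Real.pi)) ^ (2 * n - 1) *
        ((∏ l, |y j - z l|) * ∏ p ∈ univ.erase j, |y j - y p|) := by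
    rw [prod_mul_distrib, prod_const, hTcard, prod_disjSum]
    rfl
  rw [← hprod]
  refine prod_le_prod (fun _ _ => by positivity) fun q _ => ?_
  have hdist : |y j - v q| ≤ (n - 1) * Real.pi / Ω := by
    have h1 := hy j
    have h2 := hv q
    simp only [sourceInterval, Set.mem_Icc] at h1 h2
    have : ((n : ℝ) - 1) * Real.pi / Ω =
      ((n : ℝ) - 1) * Real.pi / (2 * Ω) + ((n : ℝ) - 1) * Real.pi / (2 * Ω) := by
      field_simp; ring
    rw [this, abs_le]
    constructor <;> linarith
  have habs : |y j * h - v q * h| = |y j - v q| * h := by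
    rw [← sub_mul, abs_mul, abs_of_pos hh0]
  have hle : |y j * h - v q * h| ≤ Real.pi := by
    rw [habs]
    calc |y j - v q| * h ≤ (n - 1) * Real.pi / Ω * h := by gcongr
      _ = (2 * n - 2) / N * Real.pi := by rw [hh]; field_simp
      _ ≤ 1 * Real.pi := by
        gcongr
        rw [div_le_one (by linarith)]
        linarith
      _ = Real.pi := one_mul _
  have := two_div_pi_mul_le_norm_exp_sub hle
  rw [habs] at this
  calc 4 * Ω / (N * Real.pi) * |y j - v q| = 2 / Real.pi * (|y j - v q| * h) := by
        rw [hh]; field_simp; ring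
    _ ≤ _ := this
    _ = _ := by
      simp only [X, Sum.elim_inl]
      push_cast
      simp only [mul_assoc]

/-! ### Atoms, minimal amplitude and minimal separation -/

theorem discreteMeasure_singleton_ne_zero {k : ℕ} (a x : Fin k → ℝ) (ha : ∀ j, 0 < a j) (t : ℝ) :
    discreteMeasure a x {t} ≠ 0 ↔ t ∈ Set.range x := by
  simp only [discreteMeasure, Measure.finsetSum_apply, Measure.smul_apply, smul_eq_mul, ne_eq,
    sum_eq_zero_iff, mem_univ, true_imp_iff, Set.mem_range, not_forall, mul_eq_zero,
    ENNReal.ofReal_eq_zero, not_le.2 (ha _), false_or]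
  simp [Set.indicator_apply]

theorem sources_discreteMeasure {k : ℕ} (a x : Fin k → ℝ) (ha : ∀ j, 0 < a j) :
    sources (discreteMeasure a x) = Set.range x :=
  Set.ext fun t => discreteMeasure_singleton_ne_zero a x ha t

theorem l0norm_discreteMeasure {k : ℕ} (a x : Fin k → ℝ) (ha : ∀ j, 0 < a j)
    (hx : Function.Injective x) : l0norm (discreteMeasure a x) = k := by
  rw [l0norm, sources_discreteMeasure a x ha, ← Set.image_univ,
    Set.ncard_image_of_injective _ hx, Set.ncard_univ, Nat.card_fin]

theorem mMin_le {n : ℕ} (a : Fin n → ℝ) (j : Fin n) : mMin a ≤ a j :=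
  ciInf_le (Set.finite_range _).bddBelow j

theorem mMin_pos {n : ℕ} (hn : 1 ≤ n) (a : Fin n → ℝ) (ha : ∀ j, 0 < a j) : 0 < mMin a := by
  have : Nonempty (Fin n) := ⟨⟨0, hn⟩⟩
  obtain ⟨j, hj⟩ := exists_eq_ciInf_of_finite (f := a)
  rw [mMin, ← hj]
  exact ha j

theorem dMin_le {n : ℕ} (y : Fin n → ℝ) (i j : Fin n) (hij : i ≠ j) : dMin y ≤ |y i - y j| :=
  ciInf_le (f := fun p : {p : Fin n × Fin n // p.1 ≠ p.2} => |y p.1.1 - y p.1.2|)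
    (Set.finite_range _).bddBelow ⟨(i, j), hij⟩

/-! ### Stability of the locations -/

theorem pow_separation_le (m : ℕ) {Ω s d : ℝ} (hΩ : 0 < Ω) (hs : 0 < s)
    (h : 5.88 * Real.pi * Real.exp 1 / Ω * s ^ (1 / (2 * ((m + 1 : ℕ) : ℝ) - 1)) ≤ d) :
    (11.76 * Real.exp 1 * (Real.pi / (2 * Ω))) ^ (2 * m + 1) * s ≤ d ^ (2 * m + 1) := by
  have hN : (2 * ((m + 1 : ℕ) : ℝ) - 1) = ((2 * m + 1 : ℕ) : ℝ) := by push_cast; ring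
  have hroot : (s ^ (1 / (2 * ((m + 1 : ℕ) : ℝ) - 1))) ^ (2 * m + 1) = s := by
    rw [hN, one_div, Real.rpow_inv_natCast_pow hs.le (by omega)]
  calc _ = (5.88 * Real.pi * Real.exp 1 / Ω) ^ (2 * m + 1) *
        (s ^ (1 / (2 * ((m + 1 : ℕ) : ℝ) - 1))) ^ (2 * m + 1) := by
        rw [hroot]
        congr 2
        field_simp
        norm_num
    _ ≤ d ^ (2 * m + 1) := by
        rw [← mul_pow]
        gcongr

theorem locations_stable {m k : ℕ} (hm : 1 ≤ m) {Ω σ : ℝ} (hΩ : 0 < Ω) (hσ : 0 < σ)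
    (a y : Fin (m + 1) → ℝ) (ha : ∀ j, 0 < a j) (hy : ∀ j, y j ∈ sourceInterval (m + 1) Ω)
    (hsep : 5.88 * Real.pi * Real.exp 1 / Ω *
      (σ / mMin a) ^ (1 / (2 * ((m + 1 : ℕ) : ℝ) - 1)) ≤ dMin y)
    (b x : Fin k → ℝ) (hb : ∀ j, 0 < b j) (z : Fin (m + 1) → ℝ)
    (hz : ∀ l, z l ∈ sourceInterval (m + 1) Ω) (hxz : ∀ i, ∃ l, z l = x i)
    (hclose : ∀ ω ∈ Set.Icc (-Ω) Ω,
      ‖fourierData (discreteMeasure a y) ω - fourierData (discreteMeasure b x) ω‖ ≤ 2 * σ) :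
    ∃ τ : Equiv.Perm (Fin (m + 1)), (∀ j, |y j - z (τ j)| < dMin y / 2) ∧
      ∀ j, |y j - z (τ j)| ≤ locationConstant (m + 1) / Ω *
        superResolutionFactor Ω (dMin y) ^ (2 * (m + 1) - 2) * (σ / mMin a) := by
  have hmm : 0 < mMin a := mMin_pos (by omega) a ha
  set s := σ / mMin a with hs
  have hs0 : 0 < s := div_pos hσ hmm
  set d := dMin y with hd
  have hd0 : 0 < d := lt_of_lt_of_le (by positivity) hsep
  have hdpow := pow_separation_le m hΩ hs0 hsep
  set A := Real.pi / (2 * Ω) with hA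
  have hA0 : 0 < A := by positivity
  -- The main inequality gives `2s((2m+1)A)^(2m+1)`; trading `(2m+1)^(2m+1)` for a multiple of
  -- `(m!)²` lets it cancel against `B²`.
  set ε := 2 * s * (A ^ (2 * m + 1) * ((2 * (m : ℝ) + 1) * 4 ^ m * Real.exp 1 ^ (2 * m + 1) *
    (m.factorial : ℝ) ^ 2)) with hεdef
  set B := (m.factorial : ℝ) * (d / 2) ^ m with hB
  have hf0 : (0 : ℝ) < m.factorial := by exact_mod_cast m.factorial_pos
  have hB0 : 0 < B := by positivity
  have hdist : ∀ i j, i ≠ j → d ≤ |y i - y j| := dMin_le y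
  have hBP : ∀ j, B ≤ ∏ p ∈ univ.erase j, |y j - y p| := fun j => by
    have := factorial_mul_pow_le_prod y d hd0.le j (univ.erase j) (notMem_erase _ _)
      (fun i _ j _ hij => hdist i j hij)
    rwa [card_erase_of_mem (mem_univ j), card_univ, Fintype.card_fin, Nat.add_sub_cancel] at this
  have hprod : ∀ j, (∏ l, |y j - z l|) * ∏ p ∈ univ.erase j, |y j - y p| ≤ ε := fun j => by
    have h := prod_dist_mul_prod_dist_le (by omega) hΩ a y ha hy b x hb z hz hxz hclose j
    rw [show 2 * (m + 1) - 1 = 2 * m + 1 by omega] at h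
    set R := (∏ l, |y j - z l|) * ∏ p ∈ univ.erase j, |y j - y p|
    have hR0 : 0 ≤ R := mul_nonneg (prod_nonneg fun _ _ => abs_nonneg _)
      (prod_nonneg fun _ _ => abs_nonneg _)
    have hN0 : (0 : ℝ) < 2 * m + 1 := by positivity
    have hG : 4 * Ω / ((2 * ((m + 1 : ℕ) : ℝ) - 1) * Real.pi) = 2 * ((2 * (m : ℝ) + 1) * A)⁻¹ := by
      have : (2 * ((m + 1 : ℕ) : ℝ) - 1) = 2 * m + 1 := by push_cast; ring
      rw [this, hA]
      field_simp
      norm_num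
    rw [hG, mul_pow, inv_pow] at h
    have h2 : mMin a * (2 ^ (2 * m + 1) * (((2 * (m : ℝ) + 1) * A) ^ (2 * m + 1))⁻¹ * R) ≤
        2 ^ (2 * m + 1) * (2 * σ) := le_trans (by gcongr; exact mMin_le a j) h
    have h3 : R ≤ 2 * s * ((2 * (m : ℝ) + 1) * A) ^ (2 * m + 1) := by
      rw [hs]
      set G := ((2 * (m : ℝ) + 1) * A) ^ (2 * m + 1)
      have hG0 : 0 < G := by positivity
      have h4 : R = mMin a * (2 ^ (2 * m + 1) * G⁻¹ * R) * (G / (mMin a * 2 ^ (2 * m + 1))) := by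
        field_simp
      calc R = _ := h4
        _ ≤ 2 ^ (2 * m + 1) * (2 * σ) * (G / (mMin a * 2 ^ (2 * m + 1))) := by gcongr
        _ = _ := by field_simp
    refine h3.trans ?_
    rw [hεdef, mul_pow, mul_comm (_ ^ _) (A ^ _)]
    gcongr
    exact pow_self_le_factorial_sq m hm
  have hε : 4 * (Fintype.card (Fin (m + 1)) : ℝ) * ε < d * B ^ 2 := by
    rw [Fintype.card_fin]
    have hdB : d * B ^ 2 = (m.factorial : ℝ) ^ 2 * d ^ (2 * m + 1) / 4 ^ m := by
      rw [hB, mul_pow, ← pow_mul, div_pow, mul_comm m 2, pow_mul 2 2 m]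
      norm_num
      ring
    rw [hdB, lt_div_iff₀ (by positivity)]
    refine lt_of_lt_of_le ?_ (mul_le_mul_of_nonneg_left hdpow (by positivity))
    have hc := separation_constant_bound m hm
    have h16 : (16 : ℝ) ^ m = 4 ^ m * 4 ^ m := by rw [← mul_pow]; norm_num
    set K := (m.factorial : ℝ) ^ 2 * A ^ (2 * m + 1) * Real.exp 1 ^ (2 * m + 1) * s
    have hK : 0 < K := by positivity
    calc _ = 8 * ((m : ℝ) + 1) * (2 * m + 1) * 16 ^ m * K := by
          rw [hεdef, h16]; push_cast; ring
      _ < 11.76 ^ (2 * m + 1) * K := by gcongr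
      _ = _ := by rw [mul_pow, mul_pow]; ring
  have hex := exists_dist_lt_half hd0 hB0 ⟨0⟩ hdist hBP hprod hε
  choose g hg using hex
  have hginj : Function.Injective g := fun l₁ l₂ h =>
    eq_of_dist_lt_half hd0 hB0 hdist hBP hprod hε (hg l₁) (by rw [h]; exact hg l₂)
  let e : Equiv.Perm (Fin (m + 1)) := Equiv.ofBijective g (Finite.injective_iff_bijective.1 hginj)
  have hτ : ∀ j, |y j - z (e.symm j)| < d / 2 := fun j => by
    have := hg (e.symm j)
    rwa [show g (e.symm j) = j from e.apply_symm_apply j] at this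
  refine ⟨e.symm, hτ, fun j => (dist_le_of_matching hB0 hdist hBP hprod e.symm hτ j).trans ?_⟩
  rw [Fintype.card_fin, Nat.add_sub_cancel, show 2 * (m + 1) - 2 = 2 * m by omega]
  have hc := location_constant_bound m hm
  have h8 : (8 : ℝ) ^ m = 2 ^ m * 4 ^ m := by rw [← mul_pow]; norm_num
  have h2 : (2 : ℝ) ^ (2 * m) = 4 ^ m := by rw [pow_mul]; norm_num
  have hAp : A ^ (2 * m + 1) = Real.pi ^ (2 * m) * Real.pi / (4 ^ m * 2 * (Ω ^ (2 * m) * Ω)) := by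
    rw [hA, div_pow, mul_pow, pow_succ, pow_succ, pow_succ, h2]
  calc 2 ^ m * ε / B ^ 2
      = 8 ^ m * Real.pi * (2 * (m : ℝ) + 1) * Real.exp 1 ^ (2 * m + 1) / Ω *
        superResolutionFactor Ω d ^ (2 * m) * s := by
        have hB2 : B ^ 2 = (m.factorial : ℝ) ^ 2 * (d ^ (2 * m) / 4 ^ m) := by
          rw [hB, mul_pow, ← pow_mul, div_pow, mul_comm m 2, h2]
        rw [hεdef, hB2, hAp, superResolutionFactor, h8, div_pow, mul_pow]
        field_simp
    _ ≤ _ := by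
        have : 0 < superResolutionFactor Ω d := by unfold superResolutionFactor; positivity
        gcongr

/-- Padding a family of fewer than `n` points to a non-injective family indexed by `Fin n`. -/
theorem exists_not_injective_padding {n k : ℕ} (hn : 2 ≤ n) (hk : k < n) (S : Set ℝ)
    (hS : S.Nonempty) (x : Fin k → ℝ) (hx : ∀ i, x i ∈ S) :
    ∃ z : Fin n → ℝ, (∀ l, z l ∈ S) ∧ (∀ i, ∃ l, z l = x i) ∧ ¬ Function.Injective z := by
  rcases Nat.eq_zero_or_pos k with rfl | hk0
  · obtain ⟨t, ht⟩ := hS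
    refine ⟨fun _ => t, fun _ => ht, fun i => i.elim0, fun h => ?_⟩
    have := @h ⟨0, by omega⟩ ⟨1, by omega⟩ rfl
    simp at this
  · refine ⟨fun l => if h : l.1 < k then x ⟨l, h⟩ else x ⟨0, hk0⟩, fun l => ?_, fun i => ?_,
      fun h => ?_⟩
    · dsimp only
      split_ifs <;> exact hx _
    · exact ⟨⟨i, i.2.trans hk⟩, by simp⟩
    · have := @h ⟨0, by omega⟩ ⟨k, hk⟩ (by simp [hk0])
      simp only [Fin.mk.injEq] at this
      omega

theorem isWithinNeighborhood_of_matching {n : ℕ} {d : ℝ} (hd : 0 < d) {y z : Fin n → ℝ}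
    (hsep : ∀ i j, i ≠ j → d ≤ |y i - y j|) (τ : Equiv.Perm (Fin n))
    (hτ : ∀ j, |y j - z (τ j)| < d / 2) : IsWithinNeighborhood (d / 2) y z := by
  have hmem : ∀ k j, z j ∈ Set.Ioo (y k - d / 2) (y k + d / 2) ↔ |y k - z j| < d / 2 := by
    intro k j
    rw [Set.mem_Ioo, abs_lt]
    constructor <;> rintro ⟨h₁, h₂⟩ <;> constructor <;> linarith
  have huniq : ∀ k l t, |y k - t| < d / 2 → |y l - t| < d / 2 → k = l := by
    intro k l t h₁ h₂
    by_contra hkl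
    have h₃ := hsep k l hkl
    have h₄ : |y k - y l| ≤ |y k - t| + |t - y l| := abs_sub_le _ _ _
    rw [abs_sub_comm t] at h₄
    linarith
  refine ⟨by linarith, fun k l hkl => ?_, fun j => ?_, fun k => ?_⟩
  · refine Set.disjoint_left.2 fun t h₁ h₂ => hkl (huniq k l t ?_ ?_) <;>
      rw [abs_lt] <;> constructor <;> linarith [h₁.1, h₁.2, h₂.1, h₂.2]
  · refine ⟨τ.symm j, (hmem _ _).2 (by simpa using hτ (τ.symm j)), fun k hk => ?_⟩
    exact huniq k _ (z j) ((hmem _ _).1 hk) (by simpa using hτ (τ.symm j))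
  · refine ⟨τ k, (hmem _ _).2 (hτ k), fun j hj => ?_⟩
    have := huniq k _ (z j) ((hmem _ _).1 hj) (by simpa using hτ (τ.symm j))
    rw [this, Equiv.apply_symm_apply]

end PositiveSuperresolution

/-! ### Minimal number of atoms and stability of solutions -/

open PositiveSuperresolution in
theorem theorem2p6 (n : ℕ) (hn : 2 ≤ n) (Ω σ : ℝ) (hΩ : 0 < Ω)
    (a y : Fin n → ℝ) (ha : ∀ j, 0 < a j)
    (hy : ∀ j, y j ∈ PositiveSuperresolution.sourceInterval n Ω)
    (hσ : σ ≤ PositiveSuperresolution.mMin a)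
    (Y W : ℝ → ℂ)
    (hY : ∀ ω ∈ Set.Icc (-Ω) Ω, Y ω = PositiveSuperresolution.fourierData
      (PositiveSuperresolution.discreteMeasure a y) ω + W ω)
    (hW : ∀ ω ∈ Set.Icc (-Ω) Ω, ‖W ω‖ < σ)
    (hsep : 5.88 * Real.pi * Real.exp 1 / Ω *
        (σ / PositiveSuperresolution.mMin a) ^ (1 / (2 * (n : ℝ) - 1)) ≤
      PositiveSuperresolution.dMin y)
    (O : Set ℝ) (hO : O ⊆ PositiveSuperresolution.sourceInterval n Ω) :
    ((∀ j, y j ∈ O) →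
      (∃ ρ, PositiveSuperresolution.IsL0Solution O Ω σ Y ρ) ∧
      ∀ ρ, PositiveSuperresolution.IsL0Solution O Ω σ Y ρ →
        PositiveSuperresolution.l0norm ρ = n) ∧
    ∀ a' y' : Fin n → ℝ, (∀ j, 0 < a' j) →
      PositiveSuperresolution.IsL0Solution O Ω σ Y
        (PositiveSuperresolution.discreteMeasure a' y') →
      PositiveSuperresolution.IsWithinNeighborhood (PositiveSuperresolution.dMin y / 2) y y' ∧
      ∃ τ : Equiv.Perm (Fin n), ∀ j,
        |y' (τ j) - y j| ≤ PositiveSuperresolution.locationConstant n / Ω *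
          PositiveSuperresolution.superResolutionFactor Ω (PositiveSuperresolution.dMin y) ^
            (2 * n - 2) *
          (σ / PositiveSuperresolution.mMin a) := by
  obtain ⟨m, rfl⟩ : ∃ m, n = m + 1 := ⟨n - 1, by omega⟩
  have hm : 1 ≤ m := by omega
  have hσ0 : 0 < σ := (norm_nonneg _).trans_lt (hW 0 ⟨by linarith, hΩ.le⟩)
  have hmm : 0 < mMin a := mMin_pos (by omega) a ha
  have hd0 : 0 < dMin y := lt_of_lt_of_le (by positivity) hsep
  have hyinj : Function.Injective y := fun i j hij => by
    by_contra hne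
    have := dMin_le y i j hne
    rw [hij, sub_self, abs_zero] at this
    linarith
  have hclose : ∀ ρ, IsFeasible O Ω σ Y ρ → ∀ ω ∈ Set.Icc (-Ω) Ω,
      ‖fourierData (discreteMeasure a y) ω - fourierData ρ ω‖ ≤ 2 * σ := fun ρ hρ ω hω => by
    have h₁ := hρ.close ω hω
    have h₂ := hW ω hω
    rw [hY ω hω] at h₁
    calc _ = ‖-(fourierData ρ ω - (fourierData (discreteMeasure a y) ω + W ω)) - W ω‖ := by
          congr 1; ring
      _ ≤ _ := norm_sub_le _ _
      _ ≤ 2 * σ := by rw [norm_neg]; linarith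
  have hlower : ∀ ρ, IsFeasible O Ω σ Y ρ → m + 1 ≤ l0norm ρ := fun ρ hρ => by
    obtain ⟨k, b, x, hb, hx, rfl⟩ := hρ.discrete
    rw [l0norm_discreteMeasure b x hb hx]
    by_contra! hk
    have hsup := hρ.supported
    rw [sources_discreteMeasure b x hb] at hsup
    obtain ⟨z, hz, hxz, hninj⟩ := exists_not_injective_padding hn hk (sourceInterval (m + 1) Ω)
      ⟨y 0, hy 0⟩ x fun i => hO (hsup ⟨i, rfl⟩)
    obtain ⟨τ, hτ, -⟩ := locations_stable hm hΩ hσ0 a y ha hy hsep b x hb z hz hxz (hclose _ hρ)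
    have hN := isWithinNeighborhood_of_matching hd0 (dMin_le y) τ hτ
    -- Equal values `z l₁ = z l₂` lie in the same neighborhood, which holds only one index.
    refine hninj fun l₁ l₂ hl => ?_
    obtain ⟨k, hk, -⟩ := hN.mem_unique l₁
    exact (hN.unique_mem k).unique hk (by rwa [hl] at hk)
  refine ⟨fun hyO => ?_, fun a' y' ha' hsol => ?_⟩
  · have hμ : IsFeasible O Ω σ Y (discreteMeasure a y) := by
      refine ⟨⟨m + 1, a, y, ha, hyinj, rfl⟩, ?_, fun ω hω => ?_⟩
      · rw [sources_discreteMeasure a y ha]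
        rintro _ ⟨j, rfl⟩
        exact hyO j
      · rw [hY ω hω, sub_add_cancel_left, norm_neg]
        exact hW ω hω
    have hμn := l0norm_discreteMeasure a y ha hyinj
    exact ⟨⟨_, hμ, fun ρ' hρ' => hμn.le.trans <| hlower ρ' hρ'⟩, fun ρ hρ =>
      le_antisymm (hμn ▸ hρ.minimal _ hμ) (hlower ρ hρ.feasible)⟩
  · have hsup := hsol.feasible.supported
    rw [sources_discreteMeasure a' y' ha'] at hsup
    obtain ⟨τ, hτ, hbound⟩ := locations_stable hm hΩ hσ0 a y ha hy hsep a' y' ha' y'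
      (fun l => hO (hsup ⟨l, rfl⟩)) (fun i => ⟨i, rfl⟩) (hclose _ hsol.feasible)
    refine ⟨isWithinNeighborhood_of_matching hd0 (dMin_le y) τ hτ, τ, fun j => ?_⟩
    rw [abs_sub_comm]
    exact hbound j
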